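/- Let $\gamma$ be the Euler constant, let $\psi=\Gamma'/\Gamma$ be the digamma function, let $\zeta$ be the Riemann zeta function, and let $\mathrm{Cl}_2(\theta)=\sum_{m=1}^\infty \frac{\sin(m\theta)}{m^2}$ for real $\theta$ (Clausen's function). Let $k$ be a positive integer. Then $\gamma+\psi(1+kn)=\sum_{j=1}^{kn}\frac1j$ for every integer $n\ge 1$, the following two series converge absolutely, and $$\sum_{n=1}^\infty\frac{1}{n^2}\bigl[\gamma+\psi(1+kn)\bigr]=\left(\frac{k^2}{2}+\frac{3}{2k}\right)\zeta(3)+\pi\sum_{j=1}^{k-1}j\,\mathrm{Cl}_2\!\left(\frac{2\pi j}{k}\right),$$ $$\sum_{n=1}^\infty\frac{(-1)^n}{n^2}\bigl[\gamma+\psi(1+kn)\bigr]=\left(\frac{k^2}{2}-\frac{9}{8k}\right)\zeta(3)+\pi\sum_{j=1}^{k-1}j\,\mathrm{Cl}_2\!\left(\frac{2\pi j}{k}+\frac{\pi}{k}\right),$$ where the sums over $j$ are zero when $k=1$. -/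

import Mathlib

/-- Clausen's function `Cl₂(θ) = ∑_{m ≥ 1} sin (m θ) / m ^ 2`. The series converges absolutely for
every real `θ`, see `summable_clausenTwo`. -/
noncomputable def clausenTwo (θ : ℝ) : ℝ :=
  ∑' m : ℕ, Real.sin (((m : ℝ) + 1) * θ) / ((m : ℝ) + 1) ^ 2

theorem summable_clausenTwo (θ : ℝ) :
    Summable (fun m : ℕ => Real.sin (((m : ℝ) + 1) * θ) / ((m : ℝ) + 1) ^ 2) := by
  have h : Summable (fun m : ℕ => 1 / ((m : ℝ) + 1) ^ 2) := by
    have h2 := (summable_nat_add_iff 1).mpr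
      (Real.summable_one_div_nat_pow (p := 2) |>.mpr (by norm_num))
    simpa using h2
  refine h.of_norm_bounded (fun m => ?_)
  have hm : (0 : ℝ) < ((m : ℝ) + 1) ^ 2 := by positivity
  rw [Real.norm_eq_abs, abs_div, abs_of_pos hm]
  gcongr
  exact Real.abs_sin_le_one _

/-!
At a positive integer the digamma function is a harmonic number minus the Euler constant, so both
series are of the form `∑ H_{kn} cos (2 π n s) / n ^ 2`, with `s = 0` or `s = 1 / 2`.

The heart of the proof is the closed form, for `0 ≤ θ < 2 π`,
`∑ H_n cos (n θ) / n ^ 2 = 3 / 2 ∑ cos (n θ) / n ^ 3 + ζ(3) / 2 + (θ - π) / 2 * Cl₂(θ)`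
(`hasSum_harmonic_div_sq_mul_cos`). It is the Fourier expansion of the continuous periodic function
`(π - θ) / 2 * Cl₂(θ)`: integrating the series of `Cl₂` termwise against the sawtooth gives the
coefficients `1 / 4 ∑ m ^ (-2) (1 / (m - n) + 1 / (m + n))`
(`integral_exp_mul_sawtooth_mul_clausenTwo`), and partial fractions with telescoping evaluate these
through `H_n` (`hasSum_one_div_succ_sq_mul`). They are summable, so the Fourier series converges
pointwise to the function.

Summing the closed form over `θ = 2 π (j + s) / k` for `0 ≤ j < k` keeps only the indices divisible
by `k` (`hasSum_multisection`). The cubic series is rescaled by the same relation, and in the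
Clausen term the part of `(θ - π) / 2` independent of `j` disappears, since
`∑ Cl₂(2 π (j + s) / k)` is a multiple of `Cl₂(2 π s) = 0` (`sum_range_clausenTwo`).
-/

/-! ### Digamma at positive integers, basic series -/

theorem eulerMascheroniConstant_add_digamma_nat_add_one (n : ℕ) :
    (Real.eulerMascheroniConstant : ℂ) + Complex.digamma ((n : ℂ) + 1) = (harmonic n : ℂ) := by
  have h0 : ((n.factorial : ℕ) : ℂ) ≠ 0 := by exact_mod_cast n.factorial_ne_zero
  rw [Complex.digamma_def, logDeriv_apply, Complex.deriv_Gamma_nat, Complex.Gamma_nat_eq_factorial,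
    mul_div_cancel_left₀ _ h0]
  ring

theorem summable_one_div_succ_sq : Summable (fun n : ℕ => 1 / ((n : ℝ) + 1) ^ 2) := by
  simpa using (summable_nat_add_iff 1).mpr
    (Real.summable_one_div_nat_pow (p := 2) |>.mpr (by norm_num))

theorem summable_one_div_succ_cube : Summable (fun n : ℕ => 1 / ((n : ℝ) + 1) ^ 3) := by
  simpa using (summable_nat_add_iff 1).mpr
    (Real.summable_one_div_nat_pow (p := 3) |>.mpr (by norm_num))

theorem continuous_clausenTwo : Continuous clausenTwo := by
  refine continuous_tsum (fun m => by fun_prop) summable_one_div_succ_sq fun m θ => ?_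
  have hm : (0 : ℝ) < ((m : ℝ) + 1) ^ 2 := by positivity
  rw [Real.norm_eq_abs, abs_div, abs_of_pos hm]
  gcongr
  exact Real.abs_sin_le_one _

theorem clausenTwo_zero : clausenTwo 0 = 0 := by simp [clausenTwo]

theorem clausenTwo_two_pi : clausenTwo (2 * Real.pi) = 0 := by
  have h : ∀ m : ℕ, Real.sin (((m : ℝ) + 1) * (2 * Real.pi)) = 0 := fun m =>
    Real.sin_eq_zero_iff.mpr ⟨2 * (m + 1), by push_cast; ring⟩
  simp [clausenTwo, h]

theorem clausenTwo_pi : clausenTwo Real.pi = 0 := by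
  have h : ∀ m : ℕ, Real.sin (((m : ℝ) + 1) * Real.pi) = 0 := fun m =>
    Real.sin_eq_zero_iff.mpr ⟨m + 1, by push_cast; ring⟩
  simp [clausenTwo, h]

/-! ### Fourier integrals of the sawtooth -/

/-- The Fourier coefficients of the first Bernoulli polynomial `x - 1 / 2`. At `n = 0` both sides
are zero, the right-hand side because of division by zero. -/
theorem integral_exp_mul_sawtooth (n : ℤ) :
    ∫ x in (0 : ℝ)..1, Complex.exp (-(2 * Real.pi * Complex.I * n * x)) * ((x : ℂ) - 1 / 2)
      = -1 / (2 * Real.pi * Complex.I * n) := by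
  have h := bernoulliFourierCoeff_eq one_ne_zero n
  rw [bernoulliFourierCoeff, fourierCoeffOn_eq_integral] at h
  simp only [bernoulliFun_one, fourier_coe_apply, smul_eq_mul] at h
  simp at h
  simpa using h

/-- Multiplication by a sine shifts the Fourier coefficients of the sawtooth. At `n = ±m` the
resonant term `1 / 0 = 0` is the correct value, since the sawtooth has mean zero. -/
theorem integral_exp_mul_sawtooth_mul_sin (n m : ℤ) :
    ∫ x in (0 : ℝ)..1, Complex.exp (-(2 * Real.pi * Complex.I * n * x)) *
        ((Real.pi * (1 / 2 - x) * Real.sin (m * (2 * Real.pi * x)) : ℝ) : ℂ)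
      = 1 / 4 * (1 / ((m : ℂ) - n) + 1 / (m + n)) := by
  have hpt : ∀ x : ℝ, Complex.exp (-(2 * Real.pi * Complex.I * n * x)) *
        ((Real.pi * (1 / 2 - x) * Real.sin (m * (2 * Real.pi * x)) : ℝ) : ℂ)
      = (Real.pi / (2 * Complex.I)) *
        (Complex.exp (-(2 * Real.pi * Complex.I * (n + m : ℤ) * x)) * ((x : ℂ) - 1 / 2)
        - Complex.exp (-(2 * Real.pi * Complex.I * (n - m : ℤ) * x)) * ((x : ℂ) - 1 / 2)) := by
    intro x
    have e1 : Complex.exp (-(2 * Real.pi * Complex.I * (n + m : ℤ) * x))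
        = Complex.exp (-(2 * Real.pi * Complex.I * n * x)) *
          Complex.exp (-(m * (2 * Real.pi * x)) * Complex.I) := by
      rw [← Complex.exp_add]; push_cast; ring_nf
    have e2 : Complex.exp (-(2 * Real.pi * Complex.I * (n - m : ℤ) * x))
        = Complex.exp (-(2 * Real.pi * Complex.I * n * x)) *
          Complex.exp ((m * (2 * Real.pi * x)) * Complex.I) := by
      rw [← Complex.exp_add]; push_cast; ring_nf
    rw [e1, e2]
    push_cast
    rw [Complex.sin]
    have hI : (1 : ℂ) / Complex.I = -Complex.I := by simp
    rw [← div_div, div_eq_mul_one_div _ Complex.I, hI]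
    ring
  simp_rw [hpt]
  rw [intervalIntegral.integral_const_mul, intervalIntegral.integral_sub
    (Continuous.intervalIntegrable (by fun_prop) _ _)
    (Continuous.intervalIntegrable (by fun_prop) _ _),
    integral_exp_mul_sawtooth, integral_exp_mul_sawtooth]
  have hpi : (Real.pi : ℂ) ≠ 0 := by exact_mod_cast Real.pi_ne_zero
  have key : ∀ z : ℂ, -1 / (2 * Real.pi * Complex.I * z) = -1 / (2 * Real.pi * Complex.I) * z⁻¹ :=
    fun z => by rw [div_mul_eq_div_div, div_eq_mul_inv _ z]
  rw [key, key, ← mul_sub, ← mul_assoc]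
  have hc : (Real.pi / (2 * Complex.I) : ℂ) * (-1 / (2 * Real.pi * Complex.I)) = 1 / 4 := by
    field_simp
    rw [Complex.I_sq]; norm_num
  rw [hc]
  push_cast
  rw [← neg_sub (m : ℂ) n, inv_neg, add_comm (n : ℂ) m]
  ring

/-! ### A telescoping series with harmonic number values -/

/-- By induction on `n`, with a telescoping sum in the induction step. -/
theorem tendsto_sum_one_div_add_sub (n : ℕ) :
    Filter.Tendsto (fun M : ℕ => ∑ m ∈ Finset.range M, (1 / ((m : ℝ) + 1 + n) - 1 / ((m : ℝ) + 1)))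
      Filter.atTop (nhds (-(harmonic n : ℝ))) := by
  induction n with
  | zero => simp
  | succ n ih =>
    have hlim : Filter.Tendsto (fun M : ℕ => 1 / ((M : ℝ) + 1 + n)) Filter.atTop (nhds 0) := by
      have := (tendsto_one_div_add_atTop_nhds_zero_nat (𝕜 := ℝ)).comp
        (Filter.tendsto_add_atTop_nat n)
      refine this.congr fun M => ?_
      simp only [Function.comp]; push_cast; ring_nf
    have h := ih.add (hlim.sub_const (1 / ((n : ℝ) + 1)))
    refine (h.congr fun M => ?_).trans_eq ?_
    · have ht := Finset.sum_range_sub (fun m : ℕ => 1 / ((m : ℝ) + 1 + n)) M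
      simp only [Nat.cast_zero, zero_add] at ht
      rw [add_comm 1 (n : ℝ)] at ht
      rw [← ht, ← Finset.sum_add_distrib]
      refine Finset.sum_congr rfl fun m _ => ?_
      push_cast
      ring_nf
    · rw [harmonic_succ]; push_cast; congr 1; rw [one_div]; ring

/-- The counterpart of `tendsto_sum_one_div_add_sub` for a shift to the left. The term with
`m + 1 = n` contributes only `-1 / n`, as `1 / 0 = 0`; the limit is minus the harmonic number of
index `n - 1`, which the form `1 / n - harmonic n` also gives correctly at `n = 0`. -/
theorem tendsto_sum_one_div_sub_sub (n : ℕ) :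
    Filter.Tendsto (fun M : ℕ => ∑ m ∈ Finset.range M, (1 / ((m : ℝ) + 1 - n) - 1 / ((m : ℝ) + 1)))
      Filter.atTop (nhds (1 / (n : ℝ) - (harmonic n : ℝ))) := by
  induction n with
  | zero => simp
  | succ n ih =>
    have hlim : Filter.Tendsto (fun M : ℕ => 1 / ((M : ℝ) - n)) Filter.atTop (nhds 0) := by
      rw [← Filter.tendsto_add_atTop_iff_nat n]
      refine (tendsto_one_div_atTop_nhds_zero_nat (𝕜 := ℝ)).congr fun M => ?_
      push_cast; ring_nf
    have h := ih.add (hlim.const_sub (1 / (0 - (n : ℝ))))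
    refine (h.congr fun M => ?_).trans_eq ?_
    · have ht := Finset.sum_range_sub' (fun m : ℕ => 1 / ((m : ℝ) - n)) M
      simp only [Nat.cast_zero] at ht
      rw [← ht, ← Finset.sum_add_distrib]
      refine Finset.sum_congr rfl fun m _ => ?_
      push_cast
      ring_nf
    · rw [harmonic_succ]; push_cast; congr 1; simp only [one_div, zero_sub, inv_neg]; ring

theorem abs_one_div_intCast_le_one (j : ℤ) : |1 / (j : ℝ)| ≤ 1 := by
  rcases eq_or_ne j 0 with rfl | hj
  · simp
  · rw [abs_div, abs_one]
    have : (1 : ℝ) ≤ |(j : ℝ)| := by exact_mod_cast Int.one_le_abs hj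
    exact div_le_one_of_le₀ this (abs_nonneg _)

theorem summable_one_div_succ_sq_mul (n : ℕ) :
    Summable (fun m : ℕ => 1 / ((m : ℝ) + 1) ^ 2 *
      (1 / ((m : ℝ) + 1 - n) + 1 / ((m : ℝ) + 1 + n))) := by
  refine (summable_one_div_succ_sq.mul_right 2).of_norm_bounded fun m => ?_
  rw [Real.norm_eq_abs, abs_mul, abs_of_nonneg (by positivity : (0 : ℝ) ≤ 1 / ((m : ℝ) + 1) ^ 2)]
  have h1 := abs_one_div_intCast_le_one (m + 1 - n)
  have h2 := abs_one_div_intCast_le_one (m + 1 + n)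
  push_cast at h1 h2
  gcongr
  exact (abs_add_le _ _).trans (by linarith)

/-- Partial fractions turn the summand into `1 / n ^ 2` times a telescoping one, up to a
correction at the resonant index `m + 1 = n`. -/
theorem hasSum_one_div_succ_sq_mul {n : ℕ} (hn : n ≠ 0) :
    HasSum (fun m : ℕ => 1 / ((m : ℝ) + 1) ^ 2 *
      (1 / ((m : ℝ) + 1 - n) + 1 / ((m : ℝ) + 1 + n)))
      (3 / (n : ℝ) ^ 3 - 2 * (harmonic n : ℝ) / (n : ℝ) ^ 2) := by
  rw [(summable_one_div_succ_sq_mul n).hasSum_iff_tendsto_nat]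
  have hn' : (n : ℝ) ≠ 0 := by exact_mod_cast hn
  have h := (((tendsto_sum_one_div_sub_sub n).add (tendsto_sum_one_div_add_sub n)).const_mul
    (1 / (n : ℝ) ^ 2)).add_const (2 / (n : ℝ) ^ 3)
  refine (h.congr' ?_).trans_eq ?_
  · filter_upwards [Filter.eventually_ge_atTop n] with M hM
    -- At `m + 1 = n` the summand is `1 / (2 * n ^ 3)` but the telescoping term is
    -- `-3 / (2 * n ^ 3)`, because `1 / 0 = 0` in both.
    have hdelta : ∑ m ∈ Finset.range M, (if m = n - 1 then 2 / (n : ℝ) ^ 3 else 0)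
        = 2 / (n : ℝ) ^ 3 := by
      rw [Finset.sum_ite_eq', if_pos (Finset.mem_range.mpr (by omega))]
    rw [← hdelta, ← Finset.sum_add_distrib, Finset.mul_sum, ← Finset.sum_add_distrib]
    refine Finset.sum_congr rfl fun m _ => ?_
    have hm : (m : ℝ) + 1 ≠ 0 := by positivity
    have hmn : (m : ℝ) + 1 + n ≠ 0 := by positivity
    split_ifs with hmn'
    · have : (n : ℝ) = m + 1 := by
        have : n = m + 1 := by omega
        exact_mod_cast this
      rw [this, sub_self]
      field_simp
      ring
    · have : (m : ℝ) + 1 - n ≠ 0 := by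
        rw [sub_ne_zero]
        intro h'
        have : m + 1 = n := by exact_mod_cast h'
        omega
      field_simp
      ring
  · congr 1
    field_simp
    ring

/-! ### The cosine series of the harmonic numbers over squares -/

theorem harmonic_le_three_mul_sqrt {n : ℕ} (hn : n ≠ 0) : (harmonic n : ℝ) ≤ 3 * √n := by
  have hn' : (0 : ℝ) < n := by exact_mod_cast Nat.pos_of_ne_zero hn
  have h1 : (1 : ℝ) ≤ √n := by
    rw [Real.one_le_sqrt]; exact_mod_cast Nat.one_le_iff_ne_zero.mpr hn
  have h2 : Real.log n ≤ 2 * √n := by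
    have := Real.log_le_self (Real.sqrt_nonneg n)
    rw [Real.log_sqrt hn'.le] at this
    linarith
  linarith [harmonic_le_one_add_log n]

theorem summable_harmonic_div_sq :
    Summable (fun n : ℕ => (harmonic (n + 1) : ℝ) / ((n : ℝ) + 1) ^ 2) := by
  have h : Summable (fun n : ℕ => 3 * ((n : ℝ) + 1) ^ (-(3 / 2) : ℝ)) := by
    simpa using ((summable_nat_add_iff 1).mpr
      (Real.summable_nat_rpow (p := -(3 / 2)) |>.mpr (by norm_num))).mul_left 3
  refine h.of_nonneg_of_le (fun n => ?_) fun n => ?_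
  · have : (0 : ℝ) ≤ harmonic (n + 1) := by exact_mod_cast (harmonic_pos n.succ_ne_zero).le
    positivity
  · have hp : (0 : ℝ) < (n : ℝ) + 1 := by positivity
    rw [div_le_iff₀ (by positivity), mul_assoc, ← Real.rpow_natCast, ← Real.rpow_add hp]
    have := harmonic_le_three_mul_sqrt n.succ_ne_zero
    rw [Real.sqrt_eq_rpow] at this
    push_cast at this
    convert! this using 2
    norm_num

/-- The Fourier coefficient of index `±n` of `x ↦ π (1 / 2 - x) Cl₂(2 π x)` on `[0, 1]`, written as
the series that termwise integration of `Cl₂` gives. The term with `m + 1 = n` uses `1 / 0 = 0`. -/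
noncomputable def sawtoothClausenCoeff (n : ℕ) : ℝ :=
  1 / 4 * ∑' m : ℕ, 1 / ((m : ℝ) + 1) ^ 2 * (1 / ((m : ℝ) + 1 - n) + 1 / ((m : ℝ) + 1 + n))

theorem sawtoothClausenCoeff_zero :
    sawtoothClausenCoeff 0 = 1 / 2 * ∑' m : ℕ, 1 / ((m : ℝ) + 1) ^ 3 := by
  rw [sawtoothClausenCoeff, ← tsum_mul_left, ← tsum_mul_left]
  refine tsum_congr fun m => ?_
  simp only [Nat.cast_zero, sub_zero, add_zero]
  field_simp
  norm_num

theorem sawtoothClausenCoeff_succ (n : ℕ) :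
    sawtoothClausenCoeff (n + 1) =
      3 / 4 * (1 / ((n : ℝ) + 1) ^ 3) - 1 / 2 * ((harmonic (n + 1) : ℝ) / ((n : ℝ) + 1) ^ 2) := by
  rw [sawtoothClausenCoeff, (hasSum_one_div_succ_sq_mul n.succ_ne_zero).tsum_eq]
  push_cast
  ring

/-- The series of `Cl₂` is integrated termwise, its terms being dominated by `π / (m + 1) ^ 2`. -/
theorem integral_exp_mul_sawtooth_mul_clausenTwo (n : ℤ) :
    ∫ x in (0 : ℝ)..1, Complex.exp (-(2 * Real.pi * Complex.I * n * x)) *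
        ((Real.pi * (1 / 2 - x) * clausenTwo (2 * Real.pi * x) : ℝ) : ℂ)
      = (sawtoothClausenCoeff n.natAbs : ℂ) := by
  have hint := intervalIntegral.hasSum_integral_of_dominated_convergence
    (μ := MeasureTheory.volume) (a := 0) (b := 1)
    (F := fun (m : ℕ) (x : ℝ) => Complex.exp (-(2 * Real.pi * Complex.I * n * x)) *
      ((Real.pi * (1 / 2 - x) * (Real.sin (((m : ℝ) + 1) * (2 * Real.pi * x)) /
        ((m : ℝ) + 1) ^ 2) : ℝ) : ℂ))
    (f := fun x : ℝ => Complex.exp (-(2 * Real.pi * Complex.I * n * x)) *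
        ((Real.pi * (1 / 2 - x) * clausenTwo (2 * Real.pi * x) : ℝ) : ℂ))
    (fun m _ => Real.pi * (1 / ((m : ℝ) + 1) ^ 2))
    (fun m => Continuous.aestronglyMeasurable (by fun_prop))
    (fun m => Filter.Eventually.of_forall fun x hx => by
      rw [Set.uIoc_of_le zero_le_one] at hx
      have hexp : ‖Complex.exp (-(2 * Real.pi * Complex.I * n * x))‖ = 1 := by
        rw [show -(2 * Real.pi * Complex.I * n * x) = ((-(2 * Real.pi * n * x) : ℝ) : ℂ) *
          Complex.I by push_cast; ring, Complex.norm_exp_ofReal_mul_I]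
      rw [norm_mul, hexp, one_mul, Complex.norm_real, Real.norm_eq_abs, abs_mul, abs_mul, abs_div,
        abs_of_pos Real.pi_pos, abs_of_pos (by positivity : (0 : ℝ) < ((m : ℝ) + 1) ^ 2),
        mul_assoc]
      have h1 : |1 / 2 - x| ≤ 1 := by rw [abs_le]; constructor <;> linarith [hx.1, hx.2]
      have h2 := Real.abs_sin_le_one (((m : ℝ) + 1) * (2 * Real.pi * x))
      gcongr
      calc _ ≤ 1 * (1 / ((m : ℝ) + 1) ^ 2) := by gcongr
        _ = _ := one_mul _)
    (Filter.Eventually.of_forall fun x _ => summable_one_div_succ_sq.mul_left _)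
    (by simp)
    (Filter.Eventually.of_forall fun x _ =>
      (Complex.hasSum_ofReal.mpr ((summable_clausenTwo (2 * Real.pi * x)).hasSum.mul_left
        (Real.pi * (1 / 2 - x)))).mul_left _)
  have hval : ∀ m : ℕ, ∫ x in (0 : ℝ)..1, Complex.exp (-(2 * Real.pi * Complex.I * n * x)) *
      ((Real.pi * (1 / 2 - x) * (Real.sin (((m : ℝ) + 1) * (2 * Real.pi * x)) /
        ((m : ℝ) + 1) ^ 2) : ℝ) : ℂ) =
      ((1 / 4 * (1 / ((m : ℝ) + 1) ^ 2 *
        (1 / ((m : ℝ) + 1 - n.natAbs) + 1 / ((m : ℝ) + 1 + n.natAbs))) : ℝ) : ℂ) := by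
    intro m
    have h := integral_exp_mul_sawtooth_mul_sin n ((m + 1 : ℕ) : ℤ)
    -- The coefficient is even in `n`, so `n` may be replaced by its absolute value.
    have heven : (1 / (((m : ℂ) + 1) - n) + 1 / (((m : ℂ) + 1) + n)) =
        1 / (((m : ℂ) + 1) - n.natAbs) + 1 / (((m : ℂ) + 1) + n.natAbs) := by
      rcases Int.natAbs_eq n with h | h
      · have : (n : ℂ) = (n.natAbs : ℂ) := by rw [← Int.cast_natCast, ← h]
        rw [this]
      · have : (n : ℂ) = -(n.natAbs : ℂ) := by rw [← Int.cast_natCast, ← Int.cast_neg, ← h]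
        rw [this, sub_neg_eq_add, ← sub_eq_add_neg, add_comm]
    push_cast at h heven ⊢
    rw [heven] at h
    rw [show ∀ a b c : ℂ, 1 / 4 * (a * (b + c)) = a * (1 / 4 * (b + c)) from fun a b c => by ring,
      ← h, ← intervalIntegral.integral_const_mul]
    refine intervalIntegral.integral_congr fun x _ => ?_
    ring
  simp_rw [hval] at hint
  rw [← hint.tsum_eq, ← Complex.ofReal_tsum, tsum_mul_left, sawtoothClausenCoeff]

theorem summable_sawtoothClausenCoeff : Summable sawtoothClausenCoeff := by
  rw [← summable_nat_add_iff 1]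
  simp_rw [sawtoothClausenCoeff_succ]
  exact (summable_one_div_succ_cube.mul_left _).sub (summable_harmonic_div_sq.mul_left _)

/-- The Fourier series of `x ↦ π (1 / 2 - x) Cl₂(2 π x)`. The function extends continuously to the
circle because `Cl₂` vanishes at both ends, and its Fourier coefficients are summable, so the series
converges to it at every point. -/
theorem hasSum_sawtoothClausenCoeff_mul_exp {x : ℝ} (hx : x ∈ Set.Ico (0 : ℝ) 1) :
    HasSum (fun n : ℤ => (sawtoothClausenCoeff n.natAbs : ℂ) *
        Complex.exp (2 * Real.pi * Complex.I * n * x))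
      ((Real.pi * (1 / 2 - x) * clausenTwo (2 * Real.pi * x) : ℝ) : ℂ) := by
  let G : ℝ → ℂ := fun x => ((Real.pi * (1 / 2 - x) * clausenTwo (2 * Real.pi * x) : ℝ) : ℂ)
  have hG : Continuous G := by
    have := continuous_clausenTwo
    fun_prop
  have hG01 : G 0 = G 1 := by simp [G, clausenTwo_zero, clausenTwo_two_pi]
  let f : C(AddCircle (1 : ℝ), ℂ) :=
    ⟨AddCircle.liftIco 1 0 G, AddCircle.liftIco_zero_continuous hG01 hG.continuousOn⟩
  have hcoeff : ∀ n : ℤ, fourierCoeff f n = (sawtoothClausenCoeff n.natAbs : ℂ) := by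
    intro n
    rw [← integral_exp_mul_sawtooth_mul_clausenTwo, fourierCoeff_eq_intervalIntegral _ _ 0]
    simp only [zero_add, div_one, one_smul]
    refine intervalIntegral.integral_congr_Ioo_of_le zero_le_one fun y hy => ?_
    have hf : f (y : AddCircle (1 : ℝ)) = G y :=
      AddCircle.liftIco_zero_coe_apply (f := G) (Set.Ioo_subset_Ico_self hy)
    simp only [hf, fourier_coe_apply, smul_eq_mul, G]
    push_cast
    ring_nf
  have hsum : Summable (fourierCoeff f) := by
    rw [show fourierCoeff f = fun n : ℤ => (sawtoothClausenCoeff n.natAbs : ℂ) from funext hcoeff]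
    refine Summable.of_nat_of_neg ?_ ?_ <;>
      simpa using (Complex.hasSum_ofReal.mpr summable_sawtoothClausenCoeff.hasSum).summable
  have h := has_pointwise_sum_fourier_series_of_summable hsum (x : AddCircle (1 : ℝ))
  have hfx : f (x : AddCircle (1 : ℝ)) = G x := AddCircle.liftIco_zero_coe_apply (f := G) hx
  rw [hfx] at h
  simp_rw [hcoeff, fourier_coe_apply, smul_eq_mul] at h
  simpa only [Complex.ofReal_one, div_one] using h

theorem hasSum_sawtoothClausenCoeff_mul_cos {x : ℝ} (hx : x ∈ Set.Ico (0 : ℝ) 1) :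
    HasSum (fun n : ℕ => 2 * (sawtoothClausenCoeff (n + 1) *
        Real.cos (((n : ℝ) + 1) * (2 * Real.pi * x))))
      (Real.pi * (1 / 2 - x) * clausenTwo (2 * Real.pi * x) - sawtoothClausenCoeff 0) := by
  have h := (hasSum_nat_add_iff' 1).mpr (hasSum_sawtoothClausenCoeff_mul_exp hx).nat_add_neg
  rw [← Complex.hasSum_ofReal]
  convert! h using 1
  · funext n
    simp only [Int.natAbs_neg, Int.natAbs_natCast, Complex.ofReal_mul, Complex.ofReal_cos,
      Complex.cos]
    push_cast
    ring_nf
  · simp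

theorem summable_one_div_succ_cube_mul_cos (θ : ℝ) :
    Summable fun n : ℕ => 1 / ((n : ℝ) + 1) ^ 3 * Real.cos (((n : ℝ) + 1) * θ) := by
  refine summable_one_div_succ_cube.of_norm_bounded fun n => ?_
  rw [norm_mul, Real.norm_of_nonneg (by positivity)]
  exact mul_le_of_le_one_right (by positivity) (Real.abs_cos_le_one _)

/-- The closed form of `∑ H_n cos (n θ) / n ^ 2` for `θ = 2 π x`, from which everything follows by
averaging over points `x` in arithmetic progression. -/
theorem hasSum_harmonic_div_sq_mul_cos {x : ℝ} (hx : x ∈ Set.Ico (0 : ℝ) 1) :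
    HasSum (fun n : ℕ => (harmonic (n + 1) : ℝ) / ((n : ℝ) + 1) ^ 2 *
        Real.cos (((n : ℝ) + 1) * (2 * Real.pi * x)))
      (3 / 2 * ∑' n : ℕ, 1 / ((n : ℝ) + 1) ^ 3 * Real.cos (((n : ℝ) + 1) * (2 * Real.pi * x))
        + 1 / 2 * ∑' n : ℕ, 1 / ((n : ℝ) + 1) ^ 3
        + Real.pi * (x - 1 / 2) * clausenTwo (2 * Real.pi * x)) := by
  have hc := summable_one_div_succ_cube_mul_cos (2 * Real.pi * x)
  convert! (hc.hasSum.mul_left (3 / 2)).sub (hasSum_sawtoothClausenCoeff_mul_cos hx) using 1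
  · funext n
    rw [sawtoothClausenCoeff_succ]
    ring
  · rw [sawtoothClausenCoeff_zero]
    ring

/-! ### Sums over shifted roots of unity -/

theorem sum_range_exp_shifted_roots {k : ℕ} (hk : k ≠ 0) (s : ℝ) (N : ℕ) :
    ∑ j ∈ Finset.range k,
        Complex.exp (((N * (2 * Real.pi * ((j + s) / k)) : ℝ) : ℂ) * Complex.I) =
      if k ∣ N then k * Complex.exp ((((N / k : ℕ) * (2 * Real.pi * s) : ℝ) : ℂ) * Complex.I)
      else 0 := by
  have hk' : (k : ℂ) ≠ 0 := by exact_mod_cast hk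
  set ζ := Complex.exp (2 * Real.pi * Complex.I / k) with hζ
  have hprim : IsPrimitiveRoot ζ k := Complex.isPrimitiveRoot_exp k hk
  have hterm : ∀ j : ℕ, Complex.exp (((N * (2 * Real.pi * ((j + s) / k)) : ℝ) : ℂ) * Complex.I) =
      Complex.exp (((N * (2 * Real.pi * (s / k)) : ℝ) : ℂ) * Complex.I) * (ζ ^ N) ^ j := by
    intro j
    rw [hζ, ← Complex.exp_nat_mul, ← Complex.exp_nat_mul, ← Complex.exp_add]
    push_cast
    ring_nf
  simp_rw [hterm]
  rw [← Finset.mul_sum]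
  split_ifs with h
  · obtain ⟨q, rfl⟩ := h
    rw [Nat.mul_div_cancel_left _ (Nat.pos_of_ne_zero hk), pow_mul, hprim.pow_eq_one]
    simp only [one_pow, Finset.sum_const, Finset.card_range, nsmul_eq_mul, mul_one]
    rw [mul_comm]
    congr 2
    push_cast
    field_simp
  · have hne : ζ ^ N ≠ 1 := fun h1 => h ((hprim.pow_eq_one_iff_dvd N).mp h1)
    have hgeom := mul_geom_sum (ζ ^ N) k
    rw [← pow_mul, mul_comm N k, pow_mul, hprim.pow_eq_one, one_pow, sub_self] at hgeom
    rw [(mul_eq_zero.mp hgeom).resolve_left (sub_ne_zero.mpr hne), mul_zero]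

theorem sum_range_cos_shifted_roots {k : ℕ} (hk : k ≠ 0) (s : ℝ) (N : ℕ) :
    ∑ j ∈ Finset.range k, Real.cos (N * (2 * Real.pi * ((j + s) / k))) =
      if k ∣ N then k * Real.cos ((N / k : ℕ) * (2 * Real.pi * s)) else 0 := by
  have h := congrArg Complex.re (sum_range_exp_shifted_roots hk s N)
  rw [Complex.re_sum] at h
  simp only [Complex.exp_ofReal_mul_I_re] at h
  rw [h]
  split_ifs
  · rw [← Complex.ofReal_natCast k, Complex.re_ofReal_mul, Complex.exp_ofReal_mul_I_re]
  · rfl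

theorem sum_range_sin_shifted_roots {k : ℕ} (hk : k ≠ 0) (s : ℝ) (N : ℕ) :
    ∑ j ∈ Finset.range k, Real.sin (N * (2 * Real.pi * ((j + s) / k))) =
      if k ∣ N then k * Real.sin ((N / k : ℕ) * (2 * Real.pi * s)) else 0 := by
  have h := congrArg Complex.im (sum_range_exp_shifted_roots hk s N)
  rw [Complex.im_sum] at h
  simp only [Complex.exp_ofReal_mul_I_im] at h
  rw [h]
  split_ifs
  · rw [← Complex.ofReal_natCast k, Complex.im_ofReal_mul, Complex.exp_ofReal_mul_I_im]
  · rfl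

/-- Multisection of series: summing a trigonometric series over the points `2 π (j + s) / k` keeps
only the frequencies divisible by `k`. It is used with `φ = Real.cos` and `φ = Real.sin`, for which
`hφ` is the orthogonality of the `k`-th roots of unity. -/
theorem hasSum_multisection {k : ℕ} (hk : k ≠ 0) {s : ℝ} {φ : ℝ → ℝ}
    (hφ : ∀ N : ℕ, ∑ j ∈ Finset.range k, φ (N * (2 * Real.pi * ((j + s) / k))) =
      if k ∣ N then k * φ ((N / k : ℕ) * (2 * Real.pi * s)) else 0)
    {b : ℕ → ℝ} {S : ℕ → ℝ}
    (hS : ∀ j ∈ Finset.range k, HasSum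
      (fun n : ℕ => b (n + 1) * φ (((n : ℝ) + 1) * (2 * Real.pi * ((j + s) / k)))) (S j)) :
    HasSum (fun m : ℕ => k * (b (k * (m + 1)) * φ (((m : ℝ) + 1) * (2 * Real.pi * s))))
      (∑ j ∈ Finset.range k, S j) := by
  have hkpos := Nat.pos_of_ne_zero hk
  have h := hasSum_sum hS
  have hterm : ∀ n : ℕ, ∑ j ∈ Finset.range k,
      b (n + 1) * φ (((n : ℝ) + 1) * (2 * Real.pi * ((j + s) / k))) =
      b (n + 1) * if k ∣ n + 1 then k * φ (((n + 1) / k : ℕ) * (2 * Real.pi * s)) else 0 := by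
    intro n
    rw [← Finset.mul_sum, ← hφ (n + 1)]
    push_cast
    rfl
  simp_rw [hterm] at h
  have hidx : ∀ m : ℕ, k * (m + 1) - 1 + 1 = k * (m + 1) := fun m =>
    Nat.sub_add_cancel (Nat.mul_pos hkpos m.succ_pos)
  have hinj : Function.Injective fun m : ℕ => k * (m + 1) - 1 := by
    intro m₁ m₂ h12
    have h12' : k * (m₁ + 1) = k * (m₂ + 1) := by
      rw [← hidx m₁, ← hidx m₂]
      exact congrArg (· + 1) h12
    exact Nat.succ_injective (Nat.eq_of_mul_eq_mul_left hkpos h12')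
  refine ((hinj.hasSum_iff ?_).mpr h).congr_fun fun m => ?_
  · intro n hn
    rw [if_neg, mul_zero]
    rintro ⟨q, hq⟩
    refine hn ⟨q - 1, ?_⟩
    have hq0 : q ≠ 0 := by rintro rfl; simp at hq
    simp only [Nat.sub_add_cancel (Nat.one_le_iff_ne_zero.mpr hq0), ← hq, Nat.add_sub_cancel]
  · simp only [Function.comp, hidx, dvd_mul_right, if_true, Nat.mul_div_cancel_left _ hkpos]
    push_cast
    ring

/-- The distribution relation of Clausen's function. -/
theorem sum_range_clausenTwo {k : ℕ} (hk : k ≠ 0) (s : ℝ) :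
    ∑ j ∈ Finset.range k, clausenTwo (2 * Real.pi * ((j + s) / k)) =
      1 / k * clausenTwo (2 * Real.pi * s) := by
  have hk' : (k : ℝ) ≠ 0 := by exact_mod_cast hk
  refine (hasSum_multisection hk (s := s) (sum_range_sin_shifted_roots hk s)
    (b := fun n => 1 / (n : ℝ) ^ 2) fun j _ => ?_).unique ?_
  · refine (summable_clausenTwo (2 * Real.pi * ((j + s) / k))).hasSum.congr_fun fun n => ?_
    push_cast
    ring
  · refine ((summable_clausenTwo (2 * Real.pi * s)).hasSum.mul_left (1 / (k : ℝ))).congr_fun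
      fun n => ?_
    push_cast
    field_simp

theorem sum_range_tsum_cos_div_cube {k : ℕ} (hk : k ≠ 0) (s : ℝ) :
    ∑ j ∈ Finset.range k, ∑' n : ℕ,
        1 / ((n : ℝ) + 1) ^ 3 * Real.cos (((n : ℝ) + 1) * (2 * Real.pi * ((j + s) / k))) =
      1 / (k : ℝ) ^ 2 * ∑' n : ℕ,
        1 / ((n : ℝ) + 1) ^ 3 * Real.cos (((n : ℝ) + 1) * (2 * Real.pi * s)) := by
  have hk' : (k : ℝ) ≠ 0 := by exact_mod_cast hk
  refine (hasSum_multisection hk (s := s) (sum_range_cos_shifted_roots hk s)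
    (b := fun n => 1 / (n : ℝ) ^ 3) fun j _ => ?_).unique ?_
  · refine (summable_one_div_succ_cube_mul_cos
      (2 * Real.pi * ((j + s) / k))).hasSum.congr_fun fun n => ?_
    push_cast
    ring
  · refine ((summable_one_div_succ_cube_mul_cos (2 * Real.pi * s)).hasSum.mul_left
      (1 / (k : ℝ) ^ 2)).congr_fun fun n => ?_
    push_cast
    field_simp

/-! ### Harmonic numbers along multiples of `k` -/

/-- The common form of both evaluations: `s = 0` gives the series with positive terms and
`s = 1 / 2` the alternating one. The hypothesis `hcl` removes, through the distribution relation,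
the part of the sawtooth factor that does not depend on `j`. -/
theorem hasSum_harmonic_mul_div_sq_mul_cos {k : ℕ} (hk : k ≠ 0) {s : ℝ}
    (hs : s ∈ Set.Ico (0 : ℝ) 1) (hcl : clausenTwo (2 * Real.pi * s) = 0) :
    HasSum (fun n : ℕ => (harmonic (k * (n + 1)) : ℝ) / ((n : ℝ) + 1) ^ 2 *
        Real.cos (((n : ℝ) + 1) * (2 * Real.pi * s)))
      ((k : ℝ) ^ 2 / 2 * ∑' n : ℕ, 1 / ((n : ℝ) + 1) ^ 3
        + 3 / (2 * (k : ℝ)) * ∑' n : ℕ,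
            1 / ((n : ℝ) + 1) ^ 3 * Real.cos (((n : ℝ) + 1) * (2 * Real.pi * s))
        + Real.pi * ∑ j ∈ Finset.range k, (j : ℝ) * clausenTwo (2 * Real.pi * ((j + s) / k))) := by
  have hkpos : (0 : ℝ) < k := by exact_mod_cast Nat.pos_of_ne_zero hk
  have hk' := hkpos.ne'
  have hmem : ∀ j ∈ Finset.range k, ((j : ℝ) + s) / k ∈ Set.Ico (0 : ℝ) 1 := by
    intro j hj
    have : (j : ℝ) + 1 ≤ k := by exact_mod_cast Finset.mem_range.mp hj
    have hj0 : (0 : ℝ) ≤ j := j.cast_nonneg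
    exact ⟨div_nonneg (by linarith [hs.1]) hkpos.le, by rw [div_lt_one hkpos]; linarith [hs.2]⟩
  have h := (hasSum_multisection hk (s := s) (sum_range_cos_shifted_roots hk s)
    (b := fun n => (harmonic n : ℝ) / (n : ℝ) ^ 2) fun j hj =>
      (hasSum_harmonic_div_sq_mul_cos (hmem j hj)).congr_fun
        fun n => by push_cast; rfl).mul_left (k : ℝ)
  have hsum := sum_range_clausenTwo hk s
  rw [hcl, mul_zero] at hsum
  have hsplit : ∑ j ∈ Finset.range k, Real.pi * (((j : ℝ) + s) / k - 1 / 2) *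
        clausenTwo (2 * Real.pi * ((j + s) / k)) =
      Real.pi / k * ∑ j ∈ Finset.range k, (j : ℝ) * clausenTwo (2 * Real.pi * ((j + s) / k))
        + Real.pi * (s / k - 1 / 2) *
          ∑ j ∈ Finset.range k, clausenTwo (2 * Real.pi * ((j + s) / k)) := by
    rw [Finset.mul_sum, Finset.mul_sum, ← Finset.sum_add_distrib]
    exact Finset.sum_congr rfl fun j _ => by ring
  rw [hsum, mul_zero, add_zero] at hsplit
  rw [Finset.sum_add_distrib, Finset.sum_add_distrib, hsplit, ← Finset.mul_sum,
    sum_range_tsum_cos_div_cube hk, Finset.sum_const, Finset.card_range, nsmul_eq_mul] at h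
  convert! h using 1
  · funext n
    push_cast
    field_simp
  · generalize ∑' n : ℕ, 1 / ((n : ℝ) + 1) ^ 3 * Real.cos (((n : ℝ) + 1) * (2 * Real.pi * s)) = A
    generalize ∑ j ∈ Finset.range k, (j : ℝ) * clausenTwo (2 * Real.pi * ((j + s) / k)) = B
    field_simp
    ring

theorem riemannZeta_three_eq_ofReal_tsum :
    riemannZeta 3 = ((∑' n : ℕ, 1 / ((n : ℝ) + 1) ^ 3 : ℝ) : ℂ) := by
  have h := zeta_nat_eq_tsum_of_gt_one (k := 3) (by norm_num)
  rw [show riemannZeta 3 = riemannZeta ((3 : ℕ) : ℂ) by norm_num, h, Complex.ofReal_tsum,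
    tsum_eq_zero_add']
  · simp
  · simpa using (Complex.hasSum_ofReal.mpr summable_one_div_succ_cube.hasSum).summable

theorem cos_succ_mul_pi (n : ℕ) : Real.cos (((n : ℝ) + 1) * Real.pi) = (-1) ^ (n + 1) := by
  exact_mod_cast Real.cos_nat_mul_pi (n + 1)

/-- Multisection with `k = 2` expresses the sum over both square roots of unity through the even
terms. -/
theorem tsum_alternating_one_div_succ_cube :
    ∑' n : ℕ, 1 / ((n : ℝ) + 1) ^ 3 * Real.cos (((n : ℝ) + 1) * Real.pi) =
      -(3 / 4) * ∑' n : ℕ, 1 / ((n : ℝ) + 1) ^ 3 := by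
  have h := sum_range_tsum_cos_div_cube two_ne_zero 0
  rw [Finset.sum_range_succ, Finset.sum_range_one] at h
  simp only [Nat.cast_zero, Nat.cast_one, add_zero, zero_div, mul_zero, Real.cos_zero, mul_one,
    Nat.cast_ofNat] at h
  rw [show 2 * Real.pi * (1 / 2) = Real.pi by ring] at h
  linarith

/-- The summation index `n ≥ 1` is written as `n + 1` with `n : ℕ`. -/
theorem mainTheorem1 (k : ℕ) (hk : 0 < k) :
    (∀ n : ℕ, (Real.eulerMascheroniConstant : ℂ)
        + Complex.digamma (1 + (k : ℂ) * ((n : ℂ) + 1)) = (harmonic (k * (n + 1)) : ℂ)) ∧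
    HasSum
      (fun n : ℕ => ((Real.eulerMascheroniConstant : ℂ)
        + Complex.digamma (1 + (k : ℂ) * ((n : ℂ) + 1))) / ((n : ℂ) + 1) ^ 2)
      (((k : ℂ) ^ 2 / 2 + 3 / (2 * (k : ℂ))) * riemannZeta 3
        + (Real.pi : ℂ) * ∑ j ∈ Finset.Ico 1 k,
            (j : ℂ) * (clausenTwo (2 * Real.pi * (j : ℝ) / (k : ℝ)) : ℂ)) ∧
    HasSum
      (fun n : ℕ => (-1 : ℂ) ^ (n + 1) * ((Real.eulerMascheroniConstant : ℂ)
        + Complex.digamma (1 + (k : ℂ) * ((n : ℂ) + 1))) / ((n : ℂ) + 1) ^ 2)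
      (((k : ℂ) ^ 2 / 2 - 9 / (8 * (k : ℂ))) * riemannZeta 3
        + (Real.pi : ℂ) * ∑ j ∈ Finset.Ico 1 k,
            (j : ℂ) * (clausenTwo
              (2 * Real.pi * (j : ℝ) / (k : ℝ) + Real.pi / (k : ℝ)) : ℂ)) := by
  have hk0 : k ≠ 0 := hk.ne'
  have hdig : ∀ n : ℕ, (Real.eulerMascheroniConstant : ℂ)
      + Complex.digamma (1 + (k : ℂ) * ((n : ℂ) + 1)) = (harmonic (k * (n + 1)) : ℂ) := by
    intro n
    rw [← eulerMascheroniConstant_add_digamma_nat_add_one]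
    push_cast
    rw [add_comm (1 : ℂ)]
  have hsum : ∀ g : ℕ → ℝ, ∑ j ∈ Finset.range k, (j : ℝ) * g j =
      ∑ j ∈ Finset.Ico 1 k, (j : ℝ) * g j := by
    intro g
    rw [Finset.range_eq_Ico, Finset.sum_eq_sum_Ico_succ_bot hk]
    simp
  refine ⟨hdig, ?_, ?_⟩
  · have h := hasSum_harmonic_mul_div_sq_mul_cos hk0 (s := 0) (by simp)
      (by rw [mul_zero, clausenTwo_zero])
    rw [hsum, ← Complex.hasSum_ofReal] at h
    simp only [mul_zero, Real.cos_zero, mul_one, add_zero] at h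
    convert! h using 1
    · funext n
      rw [hdig]
      push_cast
      rfl
    · rw [riemannZeta_three_eq_ofReal_tsum]
      push_cast
      simp only [mul_div_assoc]
      ring
  · have h2 : 2 * Real.pi * (1 / 2) = Real.pi := by ring
    have h := hasSum_harmonic_mul_div_sq_mul_cos hk0 (s := 1 / 2) (by norm_num)
      (by rw [h2, clausenTwo_pi])
    rw [hsum, h2, tsum_alternating_one_div_succ_cube, ← Complex.hasSum_ofReal] at h
    simp only [cos_succ_mul_pi] at h
    convert! h using 1
    · funext n
      rw [hdig]
      push_cast
      ring
    · rw [riemannZeta_three_eq_ofReal_tsum]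
      have harg : ∀ j : ℕ, 2 * Real.pi * (((j : ℝ) + 1 / 2) / k) =
          2 * Real.pi * j / k + Real.pi / k := fun j => by ring
      simp only [harg]
      push_cast
      ring
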